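/- Let $\mathcal{H}$ be a complex separable Hilbert space and let $A$ be a compact bounded linear operator on $\mathcal{H}$ with $\|A\|<1$. For a bounded operator $T$ write $|T|=(T^*T)^{1/2}$, and for $n\ge 1$ let $|T|^{1/n}$ be the positive $n$-th root of $|T|$. Then the set of operators $\{|A^n|^{1/n} : n\in\mathbb{N},\ n\ge 1\}$ is collectively compact, that is, the set $$\{\,|A^n|^{1/n}x \;:\; n\in\mathbb{N},\ n\geq 1,\ x\in\mathcal{H},\ \|x\|\le 1\,\}$$ has compact closure in $\mathcal{H}$. -/

import Mathlib

/-- A set `S` of bounded operators on `H` is collectively compact if the union of the images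
`K (closed unit ball)`, over all `K ∈ S`, has compact closure in `H`. -/
def CollectivelyCompact {H : Type*} [NormedAddCommGroup H] [InnerProductSpace ℂ H]
    (S : Set (H →L[ℂ] H)) : Prop :=
  IsCompact (closure {y : H | ∃ K ∈ S, ∃ x : H, ‖x‖ ≤ 1 ∧ K x = y})

/-- `|T| ^ (1 / n)`, where `|T|` is the positive square root of `T† T` and the power is the one of
the continuous functional calculus; it is the positive `n`-th root of `|T|` for `n ≥ 1`. -/
noncomputable def absRoot {H : Type*} [NormedAddCommGroup H] [InnerProductSpace ℂ H]
    [CompleteSpace H] (T : H →L[ℂ] H) (n : ℕ) : H →L[ℂ] H :=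
  CFC.abs T ^ (1 / (n : ℝ))

open scoped InnerProductSpace

section

variable {H : Type*} [NormedAddCommGroup H] [InnerProductSpace ℂ H]

/-! For each `ε > 0` one finite-dimensional `W` satisfies `‖A ^ n x‖ ≤ ε ^ n * ‖x‖` on `Wᗮ` for all
`n ≥ 1` at once. Log-convexity of `k ↦ ‖S ^ k x‖` for self-adjoint `S = |A ^ n|^(1/n)` turns this
into `‖S x‖ ≤ ε * ‖x‖` on `Wᗮ`; by duality `S` maps the unit ball within `ε` of `W`, which gives
total boundedness. To find `W`, split off a finite-dimensional invariant subspace of the adjoint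
carrying its large eigenvalues. Then `Wᗮ` is `A`-invariant and Gelfand's formula settles large `n`;
enlarging `W` settles the rest. -/

/-- A bounded set that is approximated within every `ε` by finite-dimensional subspaces is totally
bounded. -/
theorem totallyBounded_of_forall_exists_finiteDimensional {S : Set H} {C : ℝ}
    (hC : ∀ y ∈ S, ‖y‖ ≤ C)
    (hS : ∀ ε > 0, ∃ W : Submodule ℂ H, ∃ _ : FiniteDimensional ℂ W,
      ∀ y ∈ S, ‖y - W.starProjection y‖ ≤ ε) : TotallyBounded S := by
  rw [Metric.totallyBounded_iff]
  intro ε hε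
  obtain ⟨W, hW, hWS⟩ := hS (ε / 2) (by positivity)
  have hK : IsCompact (W.subtypeL '' Metric.closedBall (0 : W) C) :=
    (isCompact_closedBall 0 C).image W.subtypeL.continuous
  obtain ⟨t, ht, hcov⟩ := Metric.totallyBounded_iff.mp hK.totallyBounded (ε / 2) (by positivity)
  refine ⟨t, ht, fun y hy => ?_⟩
  have hmem : W.starProjection y ∈ W.subtypeL '' Metric.closedBall (0 : W) C := by
    refine ⟨W.orthogonalProjectionOnto y, ?_, rfl⟩
    rw [mem_closedBall_zero_iff]
    exact (W.norm_orthogonalProjectionOnto_apply_le y).trans (hC y hy)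
  have := hcov hmem
  simp only [Set.mem_iUnion, Metric.mem_ball, exists_prop] at this ⊢
  obtain ⟨z, hz, hd⟩ := this
  refine ⟨z, hz, ?_⟩
  calc dist y z ≤ dist y (W.starProjection y) + dist (W.starProjection y) z := dist_triangle _ _ _
    _ < ε / 2 + ε / 2 := by
        refine add_lt_add_of_le_of_lt ?_ hd
        rw [dist_eq_norm]
        exact hWS y hy
    _ = ε := by ring

/-- For a compact `T`, eigenvalues of compressions to complements of an increasing chain of
finite-dimensional invariant subspaces cannot stay away from zero. -/
theorem IsCompactOperator.exists_invariant_forall_compression_eigenvalue {T : H →L[ℂ] H}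
    (hT : IsCompactOperator T) {ε : ℝ} (hε : 0 < ε) :
    ∃ W : Submodule ℂ H, FiniteDimensional ℂ W ∧ (∀ w ∈ W, T w ∈ W) ∧
      ∀ y ∈ Wᗮ, ∀ μ : ℂ, y ≠ 0 → T y - μ • y ∈ W → ‖μ‖ ≤ ε := by
  by_contra hcon
  push Not at hcon
  have hstep : ∀ W : {W : Submodule ℂ H // FiniteDimensional ℂ W ∧ ∀ w ∈ W, T w ∈ W},
      ∃ y ∈ W.1ᗮ, ∃ μ : ℂ, ‖y‖ = 1 ∧ T y - μ • y ∈ W.1 ∧ ε < ‖μ‖ := by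
    rintro ⟨W, hW, hWT⟩
    obtain ⟨y, hy, μ, hy0, hyμ, hμ⟩ := hcon W hW hWT
    refine ⟨((‖y‖⁻¹ : ℝ) : ℂ) • y, W.orthogonal.smul_mem _ hy, μ, ?_, ?_, hμ⟩
    · rw [norm_smul]
      simp [hy0]
    · rw [map_smul, smul_comm, ← smul_sub]
      exact W.smul_mem _ hyμ
  choose f hf μ hf1 hfμ hμ using hstep
  let next : {W : Submodule ℂ H // FiniteDimensional ℂ W ∧ ∀ w ∈ W, T w ∈ W} →
      {W : Submodule ℂ H // FiniteDimensional ℂ W ∧ ∀ w ∈ W, T w ∈ W} := fun W =>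
    ⟨W.1 ⊔ Submodule.span ℂ {f W}, by
      have := W.2.1
      refine ⟨inferInstance, fun w hw => ?_⟩
      obtain ⟨a, ha, b, hb, rfl⟩ := Submodule.mem_sup.mp hw
      obtain ⟨c, rfl⟩ := Submodule.mem_span_singleton.mp hb
      have h1 : T (a + c • f W) = (T a + c • (T (f W) - μ W • f W)) + (c * μ W) • f W := by
        rw [map_add, map_smul, smul_sub, smul_smul]; abel
      rw [h1]
      exact Submodule.add_mem_sup (W.1.add_mem (W.2.2 a ha) (W.1.smul_mem _ (hfμ W)))
        (Submodule.smul_mem _ _ (Submodule.mem_span_singleton_self _))⟩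
  let V : ℕ → {W : Submodule ℂ H // FiniteDimensional ℂ W ∧ ∀ w ∈ W, T w ∈ W} := fun n =>
    next^[n] ⟨⊥, inferInstance, fun w hw => by simp_all⟩
  have hV : ∀ n, V (n + 1) = next (V n) := fun n => Function.iterate_succ_apply' _ _ _
  have hmono : Monotone fun n => (V n).1 := monotone_nat_of_le_succ fun n => by
    rw [hV]; exact le_sup_left
  have hfV : ∀ n, f (V n) ∈ (V (n + 1)).1 := fun n => by
    rw [hV]; exact le_sup_right (a := (V n).1) (Submodule.mem_span_singleton_self _)
  -- The `f (V n)`-component of the difference is exactly `μ (V n)`: everything else lies in `V n`,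
  -- which is orthogonal to `f (V n)`.
  have hsep : ∀ m n, m < n → ε < ‖T (f (V n)) - T (f (V m))‖ := by
    intro m n hmn
    have hm : T (f (V m)) ∈ (V n).1 := hmono (Nat.succ_le_of_lt hmn) ((V (m + 1)).2.2 _ (hfV m))
    have h1 : ⟪f (V n), T (f (V n)) - T (f (V m))⟫_ℂ = μ (V n) := by
      have h2 : T (f (V n)) - T (f (V m)) =
          μ (V n) • f (V n) + ((T (f (V n)) - μ (V n) • f (V n)) - T (f (V m))) := by abel
      rw [h2, inner_add_right, inner_smul_right, inner_self_eq_norm_sq_to_K, hf1,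
        Submodule.inner_left_of_mem_orthogonal ((V n).1.sub_mem (hfμ _) hm) (hf _)]
      simp
    calc ε < ‖μ (V n)‖ := hμ _
      _ = ‖⟪f (V n), T (f (V n)) - T (f (V m))⟫_ℂ‖ := by rw [h1]
      _ ≤ ‖f (V n)‖ * ‖T (f (V n)) - T (f (V m))‖ := norm_inner_le_norm _ _
      _ = _ := by rw [hf1, one_mul]
  have hK : IsCompact (closure (T '' Metric.closedBall 0 1)) :=
    IsCompactOperator.isCompact_closure_image_closedBall (f := (T : H →ₗ[ℂ] H)) hT 1
  obtain ⟨a, -, φ, hφ, hlim⟩ := hK.tendsto_subseq (x := fun n => T (f (V n))) fun n =>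
    subset_closure ⟨_, mem_closedBall_zero_iff.mpr (hf1 _).le, rfl⟩
  obtain ⟨N, hN⟩ := Metric.cauchySeq_iff'.mp hlim.cauchySeq ε hε
  have h1 := hN (N + 1) (Nat.le_succ N)
  rw [dist_eq_norm] at h1
  exact lt_asymm h1 (hsep _ _ (hφ (Nat.lt_succ_self N)))

/-- Gelfand's formula in the form of an eventual bound on the norms of the powers. -/
theorem eventually_norm_pow_le_of_forall_spectrum {𝔸 : Type*} [NormedRing 𝔸] [NormedAlgebra ℂ 𝔸]
    [CompleteSpace 𝔸] {a : 𝔸} {r ε : ℝ} (hr : 0 ≤ r) (hrε : r < ε)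
    (ha : ∀ μ ∈ spectrum ℂ a, ‖μ‖ ≤ r) : ∀ᶠ n : ℕ in Filter.atTop, ‖a ^ n‖ ≤ ε ^ n := by
  lift r to NNReal using hr
  lift ε to NNReal using r.2.trans hrε.le
  have hle : spectralRadius ℂ a ≤ (r : ENNReal) :=
    iSup₂_le fun μ hμ => ENNReal.coe_le_coe.mpr (ha μ hμ)
  have hrad : spectralRadius ℂ a < (ε : ENNReal) :=
    hle.trans_lt (ENNReal.coe_lt_coe.mpr hrε)
  filter_upwards [(spectrum.pow_nnnorm_pow_one_div_tendsto_nhds_spectralRadius a).eventually_lt_const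
    hrad, Filter.eventually_ge_atTop 1] with n hn hn1
  have hn0 : (0 : ℝ) < n := by exact_mod_cast hn1
  rw [one_div, ENNReal.rpow_inv_lt_iff hn0, ENNReal.rpow_natCast] at hn
  exact_mod_cast hn.le

/-- On an invariant subspace, the powers of an operator are eventually bounded in terms of the
spectrum of its compression. -/
theorem ContinuousLinearMap.eventually_norm_pow_apply_le_of_spectrum_compression {A : H →L[ℂ] H}
    {M : Submodule ℂ H} [CompleteSpace M] (hAM : ∀ x ∈ M, A x ∈ M) {r ε : ℝ} (hr : 0 ≤ r)
    (hrε : r < ε)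
    (hspec : ∀ μ ∈ spectrum ℂ (M.orthogonalProjectionOnto ∘L A ∘L M.subtypeL), ‖μ‖ ≤ r) :
    ∀ᶠ n : ℕ in Filter.atTop, ∀ x ∈ M, ‖(A ^ n) x‖ ≤ ε ^ n * ‖x‖ := by
  generalize hBdef : M.orthogonalProjectionOnto ∘L A ∘L M.subtypeL = B at hspec
  have hev := eventually_norm_pow_le_of_forall_spectrum (𝔸 := M →L[ℂ] M) (a := B) hr hrε hspec
  have hB : ∀ x : M, ((B x : M) : H) = A x := by
    subst hBdef
    intro x
    exact Submodule.starProjection_eq_self_iff.mpr (hAM x x.2)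
  clear hBdef
  have hBn : ∀ (n : ℕ) (x : M), (((B ^ n) x : M) : H) = (A ^ n) x := fun n => by
    induction n with
    | zero => intro x; rw [pow_zero, pow_zero]; rfl
    | succ n ih =>
      intro x
      have h1 : (B ^ (n + 1)) x = (B ^ n) (B x) := by rw [pow_succ]; rfl
      have h2 : (A ^ (n + 1)) (x : H) = (A ^ n) (A x) := by rw [pow_succ]; rfl
      rw [h1, h2, ih, hB]
  filter_upwards [hev] with n hn x hx
  rw [← hBn n ⟨x, hx⟩]
  exact (B ^ n).le_of_opNorm_le hn ⟨x, hx⟩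

/-! ### Compactness and adjoints -/

variable [CompleteSpace H]

/-- If `T` is small on the orthogonal complement of `W`, then the range of its adjoint is close to
`W`. -/
theorem norm_adjoint_sub_starProjection_le {T : H →L[ℂ] H} {W : Submodule ℂ H}
    [W.HasOrthogonalProjection] {ε : ℝ} (hε : 0 ≤ ε) (hT : ∀ x ∈ Wᗮ, ‖T x‖ ≤ ε * ‖x‖) (y : H) :
    ‖T.adjoint y - W.starProjection (T.adjoint y)‖ ≤ ε * ‖y‖ := by
  set z := T.adjoint y - W.starProjection (T.adjoint y) with hz
  have hzW : z ∈ Wᗮ := W.sub_starProjection_mem_orthogonal _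
  have h1 : ⟪z, z⟫_ℂ = ⟪T z, y⟫_ℂ := by
    rw [← ContinuousLinearMap.adjoint_inner_right]
    conv_lhs => rw [hz, inner_sub_right]
    rw [← hz, Submodule.inner_left_of_mem_orthogonal (W.starProjection_apply_mem _) hzW, sub_zero]
  have h2 : ‖z‖ * ‖z‖ ≤ (ε * ‖y‖) * ‖z‖ := by
    calc ‖z‖ * ‖z‖ = ‖⟪z, z⟫_ℂ‖ := by
          rw [inner_self_eq_norm_sq_to_K]; simp [sq]
      _ = ‖⟪T z, y⟫_ℂ‖ := by rw [h1]
      _ ≤ ‖T z‖ * ‖y‖ := norm_inner_le_norm _ _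
      _ ≤ ε * ‖z‖ * ‖y‖ := by gcongr; exact hT z hzW
      _ = (ε * ‖y‖) * ‖z‖ := by ring
  rcases (norm_nonneg z).eq_or_lt with h0 | h0
  · rw [← h0]; positivity
  · exact le_of_mul_le_mul_right h2 h0

/-- A compact operator is small on the complement of some finite-dimensional subspace. -/
theorem IsCompactOperator.exists_finiteDimensional_norm_le {T : H →L[ℂ] H}
    (hT : IsCompactOperator T) {ε : ℝ} (hε : 0 < ε) :
    ∃ W : Submodule ℂ H, FiniteDimensional ℂ W ∧ ∀ x ∈ Wᗮ, ‖T x‖ ≤ ε * ‖x‖ := by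
  have hK : IsCompact (closure (T '' Metric.closedBall 0 1)) :=
    IsCompactOperator.isCompact_closure_image_closedBall (f := (T : H →ₗ[ℂ] H)) hT 1
  obtain ⟨t, ht, hcov⟩ := Metric.totallyBounded_iff.mp
    (hK.totallyBounded.subset subset_closure) ε hε
  set F : Submodule ℂ H := Submodule.span ℂ t with hF
  have : FiniteDimensional ℂ F := FiniteDimensional.span_of_finite ℂ ht
  -- If `x` is orthogonal to the image of `F` under the adjoint, then `T x` is orthogonal to the
  -- `ε`-net spanning `F`, so Pythagoras bounds it by its distance to the net.
  refine ⟨F.map (T.adjoint : H →ₗ[ℂ] H), inferInstance, fun x hx => ?_⟩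
  have hTx : ∀ z ∈ F, ⟪z, T x⟫_ℂ = 0 := fun z hz => by
    rw [← ContinuousLinearMap.adjoint_inner_left]
    exact hx _ (Submodule.mem_map_of_mem hz)
  rcases eq_or_ne x 0 with rfl | hx0
  · simp
  have hn : 0 < ‖x‖ := norm_pos_iff.mpr hx0
  have hmem : T (((‖x‖⁻¹ : ℝ) : ℂ) • x) ∈ T '' Metric.closedBall 0 1 := by
    refine ⟨_, ?_, rfl⟩
    rw [mem_closedBall_zero_iff, norm_smul]
    simp [hn.ne']
  have := hcov hmem
  simp only [Set.mem_iUnion, Metric.mem_ball, exists_prop] at this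
  obtain ⟨z, hz, hd⟩ := this
  set u := ((‖x‖⁻¹ : ℝ) : ℂ) • x with hu
  have hzF : z ∈ F := Submodule.subset_span hz
  have horth : ⟪z, T u⟫_ℂ = 0 := by
    rw [hu, map_smul, inner_smul_right, hTx z hzF, mul_zero]
  have hle : ‖T u‖ ≤ ε := by
    have h1 : ‖T u - z‖ * ‖T u - z‖ = ‖T u‖ * ‖T u‖ + ‖z‖ * ‖z‖ := by
      rw [sub_eq_add_neg, norm_add_sq_eq_norm_sq_add_norm_sq_of_inner_eq_zero (𝕜 := ℂ) (T u) (-z)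
        (by rw [inner_neg_right, inner_eq_zero_symm.mp horth, neg_zero]), norm_neg]
    rw [dist_eq_norm] at hd
    nlinarith [norm_nonneg (T u - z), norm_nonneg (T u), norm_nonneg z, mul_self_nonneg ‖z‖]
  have hxu : ‖T u‖ = ‖x‖⁻¹ * ‖T x‖ := by
    rw [hu, map_smul, norm_smul]; simp
  rw [hxu, inv_mul_le_iff₀ hn] at hle
  linarith

/-- Schauder's theorem, by duality: smallness of `T` on `Wᗮ` puts the range of the adjoint near `W`.
-/
theorem IsCompactOperator.adjoint {T : H →L[ℂ] H} (hT : IsCompactOperator T) :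
    IsCompactOperator T.adjoint := by
  have htb : TotallyBounded (T.adjoint '' Metric.closedBall 0 1) := by
    refine totallyBounded_of_forall_exists_finiteDimensional (C := ‖T.adjoint‖) ?_ fun ε hε => ?_
    · rintro _ ⟨x, hx, rfl⟩
      exact T.adjoint.unit_le_opNorm x (mem_closedBall_zero_iff.mp hx)
    · obtain ⟨W, hW, hWT⟩ := hT.exists_finiteDimensional_norm_le hε
      refine ⟨W, hW, ?_⟩
      rintro _ ⟨x, hx, rfl⟩
      refine (norm_adjoint_sub_starProjection_le hε.le hWT x).trans ?_
      exact mul_le_of_le_one_right hε.le (mem_closedBall_zero_iff.mp hx)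
  exact (isCompactOperator_iff_isCompact_closure_image_closedBall
    (T.adjoint : H →ₗ[ℂ] H) zero_lt_one).mpr (htb.closure.isCompact_of_isClosed isClosed_closure)

/-- A nonzero spectral value of the compression of a compact operator to `M` gives an eigenvector of
the adjoint modulo the complement of `M`. -/
theorem IsCompactOperator.exists_adjoint_eigenvector_of_mem_spectrum_compression {A : H →L[ℂ] H}
    (hA : IsCompactOperator A) (M : Submodule ℂ H) [CompleteSpace M] {μ : ℂ} (hμ0 : μ ≠ 0)
    (hμ : μ ∈ spectrum ℂ (M.orthogonalProjectionOnto ∘L A ∘L M.subtypeL)) :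
    ∃ y ∈ M, y ≠ 0 ∧ A.adjoint y - star μ • y ∈ Mᗮ := by
  have hadj : star (M.orthogonalProjectionOnto ∘L A ∘L M.subtypeL) =
      M.orthogonalProjectionOnto ∘L A.adjoint ∘L M.subtypeL := by
    rw [ContinuousLinearMap.star_eq_adjoint, ContinuousLinearMap.adjoint_comp,
      ContinuousLinearMap.adjoint_comp, Submodule.adjoint_subtypeL,
      Submodule.adjoint_orthogonalProjectionOnto]
    rfl
  have hc : IsCompactOperator (M.orthogonalProjectionOnto ∘L A.adjoint ∘L M.subtypeL) :=
    (hA.adjoint.comp_clm M.subtypeL).clm_comp M.orthogonalProjectionOnto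
  have hμ' : star μ ∈ spectrum ℂ (M.orthogonalProjectionOnto ∘L A.adjoint ∘L M.subtypeL) := by
    rw [← hadj]
    have := spectrum.map_star (R := ℂ) (M.orthogonalProjectionOnto ∘L A ∘L M.subtypeL)
    rw [this]
    exact Set.star_mem_star.mpr hμ
  obtain ⟨y, hy⟩ :=
    ((hc.hasEigenvalue_iff_mem_spectrum (star_ne_zero.mpr hμ0)).mpr hμ').exists_hasEigenvector
  refine ⟨y, y.2, fun h => hy.2 (Subtype.ext h), ?_⟩
  have hy1 : M.starProjection (A.adjoint y) = star μ • (y : H) :=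
    congrArg Subtype.val hy.apply_eq_smul
  rw [← hy1]
  exact M.sub_starProjection_mem_orthogonal _

/-! ### Uniform decay of the powers -/

/-- The powers of a compact operator are eventually small on the complement of a
finite-dimensional subspace. -/
theorem IsCompactOperator.exists_finiteDimensional_eventually_pow_le {A : H →L[ℂ] H}
    (hA : IsCompactOperator A) {ε : ℝ} (hε : 0 < ε) :
    ∃ W : Submodule ℂ H, FiniteDimensional ℂ W ∧
      ∀ᶠ n : ℕ in Filter.atTop, ∀ x ∈ Wᗮ, ‖(A ^ n) x‖ ≤ ε ^ n * ‖x‖ := by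
  -- Halving `ε` provides the strict gap that Gelfand's formula needs.
  obtain ⟨W, hW, hinv, heig⟩ :=
    hA.adjoint.exists_invariant_forall_compression_eigenvalue (half_pos hε)
  refine ⟨W, hW, ContinuousLinearMap.eventually_norm_pow_apply_le_of_spectrum_compression
    (fun x hx w hw => ?_) (half_pos hε).le (half_lt_self hε) fun μ hμ => ?_⟩
  · rw [← ContinuousLinearMap.adjoint_inner_left]
    exact hx _ (hinv w hw)
  · rcases eq_or_ne μ 0 with rfl | hμ0
    · rw [norm_zero]
      exact (half_pos hε).le
    obtain ⟨y, hy, hy0, hyμ⟩ :=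
      hA.exists_adjoint_eigenvector_of_mem_spectrum_compression Wᗮ hμ0 hμ
    rw [W.orthogonal_orthogonal] at hyμ
    rw [← norm_star]
    exact heig y hy (star μ) hy0 hyμ

theorem IsCompactOperator.exists_finiteDimensional_forall_pow_le {A : H →L[ℂ] H}
    (hA : IsCompactOperator A) {ε : ℝ} (hε : 0 < ε) :
    ∃ W : Submodule ℂ H, FiniteDimensional ℂ W ∧
      ∀ n : ℕ, 1 ≤ n → ∀ x ∈ Wᗮ, ‖(A ^ n) x‖ ≤ ε ^ n * ‖x‖ := by
  obtain ⟨W, hW, hev⟩ := hA.exists_finiteDimensional_eventually_pow_le hε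
  obtain ⟨N, hN⟩ := Filter.eventually_atTop.mp hev
  have hpow : ∀ n : ℕ, IsCompactOperator (A ^ (n + 1)) := fun n => by
    rw [pow_succ']
    exact hA.comp_clm (A ^ n)
  -- `U k` serves the exponent `k + 1`, since exponent `0` is excluded.
  choose U hU hUA using fun n : ℕ =>
    (hpow n).exists_finiteDimensional_norm_le (pow_pos hε (n + 1))
  refine ⟨W ⊔ (Finset.range N).sup U, inferInstance, fun n hn x hx => ?_⟩
  rcases le_or_gt N n with h | h
  · exact hN n h x (Submodule.orthogonal_le le_sup_left hx)
  · obtain ⟨k, rfl⟩ := Nat.exists_eq_add_of_le' hn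
    have hk : U k ≤ (Finset.range N).sup U :=
      Finset.le_sup (Finset.mem_range.mpr (by omega))
    exact hUA k x (Submodule.orthogonal_le (hk.trans le_sup_right) hx)

/-! ### From powers to roots -/

/-- A power bound for a self-adjoint operator at a vector passes to the operator itself. -/
theorem IsSelfAdjoint.norm_apply_le_of_norm_pow_apply_le {S : H →L[ℂ] H} (hS : IsSelfAdjoint S)
    {n : ℕ} (hn : 1 ≤ n) {ε : ℝ} (hε : 0 ≤ ε) {x : H} (hx : ‖(S ^ n) x‖ ≤ ε ^ n * ‖x‖) :
    ‖S x‖ ≤ ε * ‖x‖ := by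
  have hlog : ∀ k, ‖(S ^ (k + 1)) x‖ ^ 2 ≤ ‖(S ^ k) x‖ * ‖(S ^ (k + 2)) x‖ := fun k => by
    have h1 : (S ^ (k + 1)) x = S ((S ^ k) x) := by rw [pow_succ']; rfl
    have h2 : (S ^ (k + 2)) x = S ((S ^ (k + 1)) x) := by rw [pow_succ']; rfl
    have h3 : ⟪(S ^ (k + 1)) x, (S ^ (k + 1)) x⟫_ℂ = ⟪(S ^ k) x, (S ^ (k + 2)) x⟫_ℂ := by
      rw [h2, ← ContinuousLinearMap.adjoint_inner_left S, hS.adjoint_eq, ← h1]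
    calc ‖(S ^ (k + 1)) x‖ ^ 2 = ‖⟪(S ^ (k + 1)) x, (S ^ (k + 1)) x⟫_ℂ‖ := by
          rw [inner_self_eq_norm_sq_to_K]; simp
      _ ≤ _ := by rw [h3]; exact norm_inner_le_norm _ _
  -- The ratios of successive norms never fall below the first one; cross-multiplied, this also
  -- covers vanishing iterates.
  have hratio : ∀ k, ‖S x‖ * ‖(S ^ k) x‖ ≤ ‖(S ^ (k + 1)) x‖ * ‖x‖ := fun k => by
    induction k with
    | zero => simp
    | succ k ih =>
      rcases (norm_nonneg ((S ^ (k + 1)) x)).eq_or_lt with h0 | h0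
      · rw [← h0, mul_zero]; positivity
      · refine le_of_mul_le_mul_right ?_ h0
        calc ‖S x‖ * ‖(S ^ (k + 1)) x‖ * ‖(S ^ (k + 1)) x‖
            = ‖S x‖ * ‖(S ^ (k + 1)) x‖ ^ 2 := by ring
          _ ≤ ‖S x‖ * (‖(S ^ k) x‖ * ‖(S ^ (k + 2)) x‖) := by gcongr; exact hlog k
          _ = (‖S x‖ * ‖(S ^ k) x‖) * ‖(S ^ (k + 2)) x‖ := by ring
          _ ≤ (‖(S ^ (k + 1)) x‖ * ‖x‖) * ‖(S ^ (k + 2)) x‖ := by gcongr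
          _ = ‖(S ^ (k + 1 + 1)) x‖ * ‖x‖ * ‖(S ^ (k + 1)) x‖ := by ring
  have hpow : ∀ k, ‖S x‖ ^ k * ‖x‖ ≤ ‖(S ^ k) x‖ * ‖x‖ ^ k := fun k => by
    induction k with
    | zero => simp
    | succ k ih =>
      calc ‖S x‖ ^ (k + 1) * ‖x‖ = ‖S x‖ * (‖S x‖ ^ k * ‖x‖) := by ring
        _ ≤ ‖S x‖ * (‖(S ^ k) x‖ * ‖x‖ ^ k) := by gcongr
        _ = (‖S x‖ * ‖(S ^ k) x‖) * ‖x‖ ^ k := by ring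
        _ ≤ (‖(S ^ (k + 1)) x‖ * ‖x‖) * ‖x‖ ^ k :=
            mul_le_mul_of_nonneg_right (hratio k) (by positivity)
        _ = ‖(S ^ (k + 1)) x‖ * ‖x‖ ^ (k + 1) := by ring
  rcases eq_or_ne x 0 with rfl | hx0
  · simp
  have hpos : 0 < ‖x‖ := norm_pos_iff.mpr hx0
  refine le_of_pow_le_pow_left₀ (by omega : n ≠ 0) (by positivity) ?_
  refine le_of_mul_le_mul_right ?_ hpos
  calc ‖S x‖ ^ n * ‖x‖ ≤ ‖(S ^ n) x‖ * ‖x‖ ^ n := hpow n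
    _ ≤ (ε ^ n * ‖x‖) * ‖x‖ ^ n := by gcongr
    _ = (ε * ‖x‖) ^ n * ‖x‖ := by ring

/-- Both squared norms equal `⟪T† T x, x⟫`. -/
theorem norm_cfcAbs_apply (T : H →L[ℂ] H) (x : H) : ‖CFC.abs T x‖ = ‖T x‖ := by
  have hsa : IsSelfAdjoint (CFC.abs T) := IsSelfAdjoint.of_nonneg (CFC.abs_nonneg T)
  have h1 : ⟪CFC.abs T x, CFC.abs T x⟫_ℂ = ⟪T x, T x⟫_ℂ := by
    calc ⟪CFC.abs T x, CFC.abs T x⟫_ℂ = ⟪(CFC.abs T * CFC.abs T) x, x⟫_ℂ := by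
          rw [mul_apply_eq_comp]
          conv_rhs => rw [← hsa.adjoint_eq, ContinuousLinearMap.adjoint_inner_left, hsa.adjoint_eq]
      _ = ⟪(star T * T) x, x⟫_ℂ := by rw [CFC.abs_mul_abs]
      _ = ⟪T x, T x⟫_ℂ := by
          rw [mul_apply_eq_comp, ContinuousLinearMap.star_eq_adjoint,
            ContinuousLinearMap.adjoint_inner_left]
  have h2 : ‖CFC.abs T x‖ ^ 2 = ‖T x‖ ^ 2 := by
    rw [inner_self_eq_norm_sq_to_K, inner_self_eq_norm_sq_to_K] at h1
    exact_mod_cast h1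
  exact (pow_left_inj₀ (norm_nonneg _) (norm_nonneg _) two_ne_zero).mp h2

theorem isSelfAdjoint_absRoot (T : H →L[ℂ] H) (n : ℕ) : IsSelfAdjoint (absRoot T n) :=
  IsSelfAdjoint.of_nonneg CFC.rpow_nonneg

theorem absRoot_pow (T : H →L[ℂ] H) {n : ℕ} (hn : 1 ≤ n) : absRoot T n ^ n = CFC.abs T := by
  have hn0 : (n : ℝ) ≠ 0 := by positivity
  rw [absRoot, ← CFC.rpow_natCast _ n CFC.rpow_nonneg,
    CFC.rpow_rpow_of_exponent_nonneg _ _ _ (by positivity) (by positivity) (CFC.abs_nonneg T),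
    one_div_mul_cancel hn0, CFC.rpow_one _ (CFC.abs_nonneg T)]

theorem norm_absRoot_apply_le {T : H →L[ℂ] H} {n : ℕ} (hn : 1 ≤ n) {ε : ℝ} (hε : 0 ≤ ε) {x : H}
    (hx : ‖T x‖ ≤ ε ^ n * ‖x‖) : ‖absRoot T n x‖ ≤ ε * ‖x‖ :=
  (isSelfAdjoint_absRoot T n).norm_apply_le_of_norm_pow_apply_le hn hε
    (by rwa [absRoot_pow T hn, norm_cfcAbs_apply])

end

theorem mainTheorem2 {H : Type*} [NormedAddCommGroup H] [InnerProductSpace ℂ H]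
    [CompleteSpace H] [TopologicalSpace.SeparableSpace H]
    (A : H →L[ℂ] H) (hA : IsCompactOperator A) (hA_norm : ‖A‖ < 1) :
    CollectivelyCompact {T : H →L[ℂ] H | ∃ n : ℕ, 1 ≤ n ∧ T = absRoot (A ^ n) n} := by
  refine TotallyBounded.isCompact_of_isClosed (TotallyBounded.closure ?_) isClosed_closure
  refine totallyBounded_of_forall_exists_finiteDimensional (C := ‖A‖) ?_ fun ε hε => ?_
  · rintro _ ⟨_, ⟨n, hn, rfl⟩, x, hx, rfl⟩
    refine (norm_absRoot_apply_le hn (norm_nonneg A) ?_).trans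
      (mul_le_of_le_one_right (norm_nonneg A) hx)
    exact ((A ^ n).le_opNorm x).trans (by gcongr; exact norm_pow_le' A hn)
  · obtain ⟨W, hW, hWA⟩ := hA.exists_finiteDimensional_forall_pow_le hε
    refine ⟨W, hW, ?_⟩
    rintro _ ⟨_, ⟨n, hn, rfl⟩, x, hx, rfl⟩
    have h := norm_adjoint_sub_starProjection_le (T := absRoot (A ^ n) n) (W := W) hε.le
      (fun x hx => norm_absRoot_apply_le hn hε.le (hWA n hn x hx)) x
    rw [(isSelfAdjoint_absRoot (A ^ n) n).adjoint_eq] at h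
    exact h.trans (mul_le_of_le_one_right hε.le hx)
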